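/- Let $A\subseteq\mathbb{N}$ be an oracle. Work in Cantor space ${}^\omega 2$ and write $[\sigma]$ for the set of infinite binary sequences extending the finite string $\sigma$. A sequence $(C_m)_{m\in\mathbb N}$ of subsets of ${}^\omega 2$ is an $A$-effective sequence of $\Pi^0_1(A)$ classes (the $C_m$ are uniformly $\Pi^0_1(A)$) if there is a set $W\subseteq\mathbb{N}\times 2^{<\omega}$, recursively enumerable in $A$, such that ${}^\omega 2\setminus C_m=\bigcup\{[\sigma] : (m,\sigma)\in W\}$ for every $m$; a single set $P$ is a $\Pi^0_1(A)$ class if ${}^\omega 2\setminus P=\bigcup\{[\sigma]:\sigma\in W\}$ for some set $W$ of strings that is recursively enumerable in $A$. A set $\mathcal F\subseteq{}^\omega 2$ is $A$-effectively meager if $\mathcal F\subseteq\bigcup_m C_m$ for some sequence $(C_m)$ of nowhere dense, uniformly $\Pi^0_1(A)$ classes. "$\Pi^0_1$" and "effectively meager" without an oracle refer to the oracle $\emptyset$. Then the following are equivalent. (i) $A$ is high, i.e. $\emptyset''\le_T A'$, where $'$ denotes the Turing jump. (ii) There is an $A$-effective sequence $(G_k)_{k\in\mathbb{N}}$ of nowhere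 dense $\Pi^0_1(A)$ classes such that each nowhere dense $\Pi^0_1$ class equals some $G_k$. (iii) $A$ is meager engulfing, i.e. there is an $A$-effectively meager set that includes every effectively meager set. -/

import Mathlib

namespace HighMeager

/-- An oracle `A ⊆ ℕ`, given by its characteristic function (as an everywhere defined partial
function, the format of oracles in Mathlib). -/
noncomputable def oracle (A : Set ℕ) : ℕ →. ℕ :=
  open Classical in fun n => Part.some (if n ∈ A then 1 else 0)

/-- Turing reducibility `B ≤_T A` of sets of natural numbers. -/
def TuringLE (B A : Set ℕ) : Prop := TuringReducible (oracle B) (oracle A)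

/-- The initial segment of length `s` of the characteristic sequence of `A`. -/
noncomputable def initSeg (A : Set ℕ) (s : ℕ) : List Bool :=
  open Classical in (List.range s).map fun i => decide (i ∈ A)

/-- The `e`-th set `W_e^A` recursively enumerable in `A`: the number `n` is enumerated iff the
`e`-th program halts on `n` together with some finite initial segment of the oracle `A`. -/
def enumSet (e : ℕ) (A : Set ℕ) : Set ℕ :=
  {n | ∃ s : ℕ, ((Denumerable.ofNat Nat.Partrec.Code e).eval
    (Nat.pair n (Encodable.encode (initSeg A s)))).Dom}

/-- The Turing jump of `A`, that is, the set of all `e` with `e ∈ W_e^A`. -/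
def jump (A : Set ℕ) : Set ℕ := {e | e ∈ enumSet e A}

/-- `A` is high: the double jump of the empty set is Turing reducible to the jump of `A`. -/
def High (A : Set ℕ) : Prop := TuringLE (jump (jump ∅)) (jump A)

/-- A predicate is recursively enumerable relative to the oracle `A` (the relativization of
Mathlib's `REPred`). -/
def REPredIn {α : Type*} [Primcodable α] (A : Set ℕ) (p : α → Prop) : Prop :=
  RecursiveIn {oracle A} fun a => Part.assert (p a) fun _ => Part.some ()

/-- The basic clopen set `[σ]` of all points of Cantor space `ℕ → Bool` that extend `σ`. -/
def cyl (σ : List Bool) : Set (ℕ → Bool) :=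
  {x | ∀ (i : ℕ) (h : i < σ.length), x i = σ[i]}

/-- `P` is a `Π⁰₁(A)` class in Cantor space: its complement is the union of the basic clopen sets
`[σ]` for `σ` in a set of strings that is r.e. in `A`. -/
def IsPi01 (A : Set ℕ) (P : Set (ℕ → Bool)) : Prop :=
  ∃ W : List Bool → Prop, REPredIn A W ∧ Pᶜ = ⋃ σ ∈ {σ | W σ}, cyl σ

/-- `C` is an `A`-effective sequence of `Π⁰₁(A)` classes, i.e. the sets `C m` are `Π⁰₁(A)`
classes uniformly in `m`. -/
def IsUniformPi01 (A : Set ℕ) (C : ℕ → Set (ℕ → Bool)) : Prop :=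
  ∃ W : ℕ × List Bool → Prop, REPredIn A W ∧ ∀ m, (C m)ᶜ = ⋃ σ ∈ {σ | W (m, σ)}, cyl σ

/-- `F` is `A`-effectively meager: it is contained in the union of a sequence of nowhere dense
sets that are uniformly `Π⁰₁(A)` classes. -/
def EffectivelyMeager (A : Set ℕ) (F : Set (ℕ → Bool)) : Prop :=
  ∃ C : ℕ → Set (ℕ → Bool), IsUniformPi01 A C ∧ (∀ m, IsNowhereDense (C m)) ∧ F ⊆ ⋃ m, C m

/-- `A` is meager engulfing: some `A`-effectively meager set includes all effectively meager
sets. -/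
def MeagerEngulfing (A : Set ℕ) : Prop :=
  ∃ S : Set (ℕ → Bool), EffectivelyMeager A S ∧
    ∀ F : Set (ℕ → Bool), EffectivelyMeager ∅ F → F ⊆ S

end HighMeager

namespace HighMeager

/-! ### Recursively enumerable predicates -/

section REPred

variable {α β : Type*} [Primcodable α] [Primcodable β]

/-! The equivalence rests on a count of quantifiers: being r.e. in the jump of `A` is the same as
being `Σ⁰₂` relative to `A` (`rePredIn_jump_of_exists_not`, `REPredIn.exists_not_of_jump`). By
Post's theorem (`turingLE_iff`), highness thus puts both `∅''` and its complement at the level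
`Σ⁰₂(A)`.

High oracles list the classes: that the `e`-th r.e. set of strings removes a dense open set is a
`Π⁰₂` property of `e`, so for high `A` it takes the form `∃ n, ¬ q e n` with `q` r.e. in `A`. Let
the class with index `⟨e, n⟩` remove the `e`-th set, and remove everything once `q e n` is seen.
Then it is empty or a correctly certified nowhere dense class, and every nowhere dense `Π⁰₁` class
appears. The union of such a list engulfs all effectively meager sets.

Engulfing oracles are high: the complement of `∅''` is `Π⁰₂`, so it consists of those `e` for which
a uniformly primitive recursive set `U e` is infinite (`exists_primrecRel_infinite`). If `U e` is
infinite, the class of points vanishing on it is nowhere dense, hence covered by the engulfing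
classes `C m`, and by Baire category some nonempty relatively open part of it lies in one `C m`. If
`U e` is finite, every such part contains a cylinder and cannot lie in a nowhere dense set. Leaving
`C m` is an event r.e. in `A`, so infinity of `U e` is `Σ⁰₂(A)` (`infinite_iff_exists_not_escape`).
-/

theorem rePred_comp {p : β → Prop} (hp : REPred p) {f : α → β} (hf : Computable f) :
    REPred fun a => p (f a) :=
  Partrec.comp hp hf

theorem rePred_of_primrec {p : α → Prop} (hp : PrimrecPred p) : REPred p :=
  hp.computablePred.to_re

theorem REPred.exists_code {p : α → Prop} (hp : REPred p) :
    ∃ c : Nat.Partrec.Code, ∀ a, p a ↔ (c.eval (Encodable.encode a)).Dom := by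
  obtain ⟨c, hc⟩ := Nat.Partrec.Code.exists_code.1 hp
  exact ⟨c, fun a => by rw [hc]; simp [Part.dom_iff_mem]⟩

/-- Every r.e. predicate has a primitive recursive enumeration in stages. -/
theorem REPred.exists_stages {p : α → Prop} (hp : REPred p) :
    ∃ R : ℕ → α → Prop, PrimrecRel R ∧ (∀ k l a, k ≤ l → R k a → R l a) ∧
      ∀ a, p a ↔ ∃ k, R k a := by
  obtain ⟨c, hc⟩ := REPred.exists_code hp
  refine ⟨fun k a => (c.evaln k (Encodable.encode a)).isSome, ?_, ?_, fun a => ?_⟩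
  · refine (Primrec.primrecPred (?_ : Primrec fun x : ℕ × α =>
      decide ((c.evaln x.1 (Encodable.encode x.2)).isSome = true)))
    refine (Primrec.option_isSome.comp (Nat.Partrec.Code.primrec_evaln.comp
      ((Primrec.fst.pair (Primrec.const c)).pair (Primrec.encode.comp Primrec.snd)))).of_eq ?_
    intro x; simp
  · intro k l a hkl h
    obtain ⟨y, hy⟩ := Option.isSome_iff_exists.1 h
    exact Option.isSome_iff_exists.2 ⟨y, Nat.Partrec.Code.evaln_mono hkl hy⟩
  · rw [hc, Part.dom_iff_mem]
    simp only [Nat.Partrec.Code.evaln_complete, Option.isSome_iff_exists]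
    exact exists_comm

theorem rePred_exists_nat {R : α → ℕ → Prop} (hR : PrimrecRel R) : REPred fun a => ∃ k, R a k := by
  classical
  have h := Partrec.rfind (Primrec₂.to_comp hR.decide).partrec₂
  refine h.dom_re.of_eq fun a => Nat.rfind_dom.trans ?_
  constructor
  · rintro ⟨k, hk, -⟩
    exact ⟨k, by simpa [eq_comm] using hk⟩
  · rintro ⟨k, hk⟩
    exact ⟨k, by simpa [eq_comm] using hk, fun _ => trivial⟩

theorem rePred_exists {p : α → β → Prop} (hp : REPred fun x : α × β => p x.1 x.2) :
    REPred fun a => ∃ b, p a b := by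
  obtain ⟨R, hR, -, h⟩ := REPred.exists_stages hp
  -- Dovetailing: a single number codes both the witness and the stage at which it is confirmed.
  have : PrimrecRel fun (a : α) (n : ℕ) =>
      ∃ b ∈ (Encodable.decode (α := β) n.unpair.1).toList, R n.unpair.2 (a, b) := by
    have h1 : PrimrecRel fun (b : β) (x : α × ℕ) => R x.2.unpair.2 (x.1, b) :=
      hR.comp (Primrec.snd.comp (Primrec.unpair.comp (Primrec.snd.comp Primrec.snd)))
        ((Primrec.fst.comp Primrec.snd).pair Primrec.fst)
    exact (PrimrecRel.exists_mem_list h1).comp (Primrec.optionToList.comp (Primrec.decode.comp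
      (Primrec.fst.comp (Primrec.unpair.comp Primrec.snd)))) Primrec.id
  refine (rePred_exists_nat this).of_eq fun a => ⟨?_, ?_⟩
  · rintro ⟨n, b, -, hb⟩
    exact ⟨b, (h (a, b)).2 ⟨_, hb⟩⟩
  · rintro ⟨b, hb⟩
    obtain ⟨k, hk⟩ := (h (a, b)).1 hb
    exact ⟨Nat.pair (Encodable.encode b) k, b, by simp, by simpa using hk⟩

theorem rePred_and {p q : α → Prop} (hp : REPred p) (hq : REPred q) :
    REPred fun a => p a ∧ q a := by
  obtain ⟨R, hR, hRm, hRp⟩ := REPred.exists_stages hp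
  obtain ⟨S, hS, hSm, hSq⟩ := REPred.exists_stages hq
  refine (rePred_exists_nat (R := fun a k => R k a ∧ S k a)
    (PrimrecPred.and hR.swap hS.swap)).of_eq fun a => ?_
  rw [hRp, hSq]
  constructor
  · rintro ⟨k, h1, h2⟩; exact ⟨⟨k, h1⟩, ⟨k, h2⟩⟩
  · rintro ⟨⟨k, h1⟩, ⟨l, h2⟩⟩
    exact ⟨max k l, hRm _ _ _ (le_max_left _ _) h1, hSm _ _ _ (le_max_right _ _) h2⟩

theorem rePred_or {p q : α → Prop} (hp : REPred p) (hq : REPred q) :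
    REPred fun a => p a ∨ q a := by
  obtain ⟨R, hR, -, hRp⟩ := REPred.exists_stages hp
  obtain ⟨S, hS, -, hSq⟩ := REPred.exists_stages hq
  refine (rePred_exists_nat (R := fun a k => R k a ∨ S k a)
    (PrimrecPred.or hR.swap hS.swap)).of_eq fun a => ?_
  rw [hRp, hSq, exists_or]

theorem primrecRel_prefix : PrimrecRel fun σ τ : List Bool => σ <+: τ := by
  have h : PrimrecRel fun σ τ : List Bool => τ.take σ.length = σ :=
    Primrec.eq.comp (Primrec.list_take.comp (Primrec.list_length.comp Primrec.fst) Primrec.snd)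
      Primrec.fst
  exact h.of_eq fun σ τ => by rw [List.prefix_iff_eq_take, eq_comm]

end REPred

/-! ### Initial segments -/

section InitSeg

variable (A : Set ℕ)

@[simp] theorem length_initSeg (s : ℕ) : (initSeg A s).length = s := by simp [initSeg]

theorem getElem?_initSeg {s i : ℕ} (h : i < s) :
    (initSeg A s)[i]? = some (open Classical in decide (i ∈ A)) := by
  simp [initSeg, h]

theorem getElem?_initSeg_eq_some {s i : ℕ} {b : Bool} :
    (initSeg A s)[i]? = some b ↔ i < s ∧ (b = true ↔ i ∈ A) := by
  by_cases h : i < s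
  · rw [getElem?_initSeg A h]
    by_cases hA : i ∈ A <;> cases b <;> simp [h, hA]
  · simp [h, initSeg]

theorem take_initSeg {s t : ℕ} (h : s ≤ t) : (initSeg A t).take s = initSeg A s := by
  simp [initSeg, ← List.map_take, List.take_range, h]

theorem initSeg_prefix {s t : ℕ} (h : s ≤ t) : initSeg A s <+: initSeg A t := by
  rw [← take_initSeg A h]; exact List.take_prefix _ _

theorem eq_initSeg_of_prefix {σ : List Bool} {t : ℕ} (h : σ <+: initSeg A t) :
    σ = initSeg A σ.length := by
  have hl : σ.length ≤ t := by simpa using h.length_le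
  rw [List.prefix_iff_eq_take.1 h]
  simp [hl, take_initSeg]

theorem initSeg_succ (s : ℕ) :
    initSeg A (s + 1) = initSeg A s ++ [open Classical in decide (s ∈ A)] := by
  simp [initSeg, List.range_succ]

theorem eq_initSeg {σ : List Bool} (h : ∀ i b, σ[i]? = some b → (b = true ↔ i ∈ A)) :
    σ = initSeg A σ.length := by
  refine List.ext_getElem? fun i => ?_
  by_cases hi : i < σ.length
  · have := h i σ[i] (by simp)
    rw [eq_comm, List.getElem?_eq_getElem hi, getElem?_initSeg_eq_some]
    exact ⟨hi, this⟩
  · simp [not_lt.1 hi]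

/-- Primitive recursion on the length, appending one oracle answer at each step. -/
theorem recursiveIn_initSeg :
    Nat.RecursiveIn {oracle A} fun s => Part.some (Encodable.encode (initSeg A s)) := by
  have hstep : Nat.Primrec fun m : ℕ =>
      Encodable.encode ((Encodable.decode (α := List Bool) m.unpair.1).getD [] ++
        [decide (m.unpair.2 = 1)]) := by
    refine Primrec.nat_iff.1 (Primrec.encode.comp (Primrec.list_concat.comp
      (Primrec.option_getD.comp (Primrec.decode.comp (Primrec.fst.comp Primrec.unpair))
        (Primrec.const [])) ?_))
    exact (Primrec.eq.comp (Primrec.snd.comp Primrec.unpair) (Primrec.const 1)).decide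
  have h22 : Nat.Primrec fun m : ℕ => m.unpair.2.unpair.2 := .comp .right .right
  have h21 : Nat.Primrec fun m : ℕ => m.unpair.2.unpair.1 := .comp .left .right
  have hh : Nat.RecursiveIn {oracle A} fun m => Part.some (Encodable.encode
      ((Encodable.decode (α := List Bool) m.unpair.2.unpair.2).getD [] ++
        [open Classical in decide (m.unpair.2.unpair.1 ∈ A)])) := by
    refine (Nat.RecursiveIn.comp hstep.recursiveIn (.pair h22.recursiveIn
      (.comp (.oracle (oracle A) (Set.mem_singleton _)) h21.recursiveIn))).of_eq fun m => ?_
    have h : ((Part.some m.unpair.2.unpair.1).bind (oracle A)) =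
        Part.some (open Classical in if m.unpair.2.unpair.1 ∈ A then 1 else 0) :=
      Part.bind_some _ (oracle A)
    change Part.bind (Nat.pair <$> Part.some m.unpair.2.unpair.2 <*>
      ((Part.some m.unpair.2.unpair.1).bind (oracle A))) _ = _
    rw [h]
    by_cases hA : m.unpair.2.unpair.1 ∈ A <;> simp [hA, Seq.seq]
  have hprec := Nat.RecursiveIn.prec
    (Nat.Primrec.const (Encodable.encode ([] : List Bool))).recursiveIn hh
  have hp : Nat.Primrec fun n : ℕ => Nat.pair 0 n := .pair .zero .id
  refine (hprec.comp hp.recursiveIn).of_eq fun s => ?_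
  change Part.bind (Part.some (Nat.pair 0 s)) _ = _
  rw [Part.bind_some]
  simp only [Nat.unpair_pair]
  generalize (Nat.unpair (Nat.pair 0 s)).1 = a
  induction s with
  | zero => rfl
  | succ s ih =>
    change Part.bind _ _ = _
    rw [ih, Part.bind_some]
    simp [initSeg_succ]

end InitSeg

/-! ### The use principle for oracle computations -/

section Use

variable (A : Set ℕ)

/-- **Use principle**: a function recursive in `A` is computed by a partial recursive functional
that reads finite initial segments of `A`, monotonically. -/
theorem exists_functional {f : ℕ →. ℕ} (hf : Nat.RecursiveIn {oracle A} f) :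
    ∃ F : List Bool → ℕ →. ℕ, Partrec₂ F ∧ (∀ σ τ n y, σ <+: τ → y ∈ F σ n → y ∈ F τ n) ∧
      ∀ n y, y ∈ f n ↔ ∃ s, y ∈ F (initSeg A s) n := by
  have base : ∀ g : ℕ →. ℕ, Nat.Partrec g →
      ∃ F : List Bool → ℕ →. ℕ, Partrec₂ F ∧ (∀ σ τ n y, σ <+: τ → y ∈ F σ n → y ∈ F τ n) ∧
      ∀ n y, y ∈ g n ↔ ∃ s, y ∈ F (initSeg A s) n := fun g hg =>
    ⟨fun _ n => g n, (Partrec.nat_iff.2 hg).comp Computable.snd, fun _ _ _ _ _ h => h,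
      fun _ _ => ⟨fun h => ⟨0, h⟩, fun ⟨_, h⟩ => h⟩⟩
  induction hf with
  | zero => exact base _ .zero
  | succ => exact base _ .succ
  | left => exact base _ .left
  | right => exact base _ .right
  | oracle g hg =>
    obtain rfl : g = oracle A := hg
    refine ⟨fun σ n => ((σ[n]?).map fun b : Bool => if b then 1 else 0 : Option ℕ), ?_, ?_, ?_⟩
    · refine Computable.ofOption (Computable.option_map Computable.list_getElem? ?_)
      exact (Primrec.ite (Primrec.eq.comp Primrec.snd (Primrec.const true))
        (Primrec.const 1) (Primrec.const 0)).to_comp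
    · rintro σ τ n y ⟨ρ, rfl⟩ h
      replace h := Part.mem_coe.1 h
      refine Part.mem_coe.2 (Option.map_eq_some_iff.2 ?_)
      obtain ⟨b, hb, rfl⟩ := Option.map_eq_some_iff.1 h
      obtain ⟨hn, -⟩ := List.getElem?_eq_some_iff.1 hb
      exact ⟨b, by rw [List.getElem?_append_left hn, hb], rfl⟩
    · intro n y
      refine Part.mem_some_iff.trans (Iff.trans ?_ (exists_congr fun s => Part.mem_coe.symm))
      simp only [Option.mem_def, Option.map_eq_some_iff, getElem?_initSeg_eq_some]
      constructor
      · rintro rfl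
        by_cases hn : n ∈ A
        · exact ⟨n + 1, true, by simp [hn], by simp [hn]⟩
        · exact ⟨n + 1, false, by simp [hn], by simp [hn]⟩
      · rintro ⟨s, b, ⟨-, hb⟩, rfl⟩
        by_cases hn : n ∈ A
        · obtain rfl := hb.2 hn
          exact (if_pos hn).symm
        · obtain rfl := Bool.eq_false_iff.2 fun h => hn (hb.1 h)
          exact (if_neg hn).symm
  | @pair f h _ _ ihf ihh =>
    obtain ⟨F, hF, mF, eF⟩ := ihf
    obtain ⟨H, hH, mH, eH⟩ := ihh
    refine ⟨fun σ n => (F σ n).bind fun a => (H σ n).map (Nat.pair a), ?_, ?_, ?_⟩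
    · exact Partrec.bind hF (Partrec.map (Partrec.comp hH Computable.fst)
        (Primrec₂.natPair.to_comp.comp (Computable.snd.comp Computable.fst) Computable.snd))
    · intro σ τ n y hst h
      simp only [Part.mem_bind_iff, Part.mem_map_iff] at h ⊢
      obtain ⟨a, ha, b, hb, rfl⟩ := h
      exact ⟨a, mF _ _ _ _ hst ha, b, mH _ _ _ _ hst hb, rfl⟩
    · intro n y
      have : y ∈ (Nat.pair <$> f n <*> h n) ↔ ∃ a ∈ f n, ∃ b ∈ h n, Nat.pair a b = y := by
        simp [Seq.seq]
      rw [this]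
      simp only [Part.mem_bind_iff, Part.mem_map_iff]
      constructor
      · rintro ⟨a, ha, b, hb, rfl⟩
        obtain ⟨s, hs⟩ := (eF _ _).1 ha
        obtain ⟨t, ht⟩ := (eH _ _).1 hb
        exact ⟨max s t, a, mF _ _ _ _ (initSeg_prefix A (le_max_left _ _)) hs,
          b, mH _ _ _ _ (initSeg_prefix A (le_max_right _ _)) ht, rfl⟩
      · rintro ⟨s, a, ha, b, hb, rfl⟩
        exact ⟨a, (eF _ _).2 ⟨s, ha⟩, b, (eH _ _).2 ⟨s, hb⟩, rfl⟩
  | @comp f h _ _ ihf ihh =>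
    obtain ⟨F, hF, mF, eF⟩ := ihf
    obtain ⟨H, hH, mH, eH⟩ := ihh
    refine ⟨fun σ n => (H σ n).bind fun a => F σ a, ?_, ?_, ?_⟩
    · exact Partrec.bind hH (hF.comp (Computable.fst.comp Computable.fst) Computable.snd)
    · intro σ τ n y hst h
      simp only [Part.mem_bind_iff] at h ⊢
      obtain ⟨a, ha, hb⟩ := h
      exact ⟨a, mH _ _ _ _ hst ha, mF _ _ _ _ hst hb⟩
    · intro n y
      refine Part.mem_bind_iff.trans ?_
      simp only [Part.mem_bind_iff]
      constructor
      · rintro ⟨a, ha, hb⟩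
        obtain ⟨s, hs⟩ := (eH _ _).1 ha
        obtain ⟨t, ht⟩ := (eF _ _).1 hb
        exact ⟨max s t, a, mH _ _ _ _ (initSeg_prefix A (le_max_left _ _)) hs,
          mF _ _ _ _ (initSeg_prefix A (le_max_right _ _)) ht⟩
      · rintro ⟨s, a, ha, hb⟩
        exact ⟨a, (eH _ _).2 ⟨s, ha⟩, (eF _ _).2 ⟨s, hb⟩⟩
  | @prec f h _ _ ihf ihh =>
    obtain ⟨F, hF, mF, eF⟩ := ihf
    obtain ⟨H, hH, mH, eH⟩ := ihh
    -- Monotonicity of the whole recursion is needed below to merge the uses of successive steps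
    -- into one initial segment.
    have mono : ∀ σ τ n a z, σ <+: τ → z ∈ (Nat.rec (F σ a) (fun y IH => IH.bind fun i =>
        H σ (Nat.pair a (Nat.pair y i))) n : Part ℕ) →
        z ∈ (Nat.rec (F τ a) (fun y IH => IH.bind fun i =>
        H τ (Nat.pair a (Nat.pair y i))) n : Part ℕ) := by
      intro σ τ n a z hst
      induction n generalizing z with
      | zero => exact mF _ _ _ _ hst
      | succ n ih =>
        simp only [Part.mem_bind_iff]
        rintro ⟨i, hi, hy⟩
        exact ⟨i, ih _ hi, mH _ _ _ _ hst hy⟩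
    refine ⟨fun σ p => p.unpair.2.rec (F σ p.unpair.1) fun y IH => IH.bind fun i =>
      H σ (Nat.pair p.unpair.1 (Nat.pair y i)), ?_, ?_, ?_⟩
    · have hu1 : Computable fun x : List Bool × ℕ => x.2.unpair.1 :=
        Computable.fst.comp (Computable.unpair.comp Computable.snd)
      have hu2 : Computable fun x : List Bool × ℕ => x.2.unpair.2 :=
        Computable.snd.comp (Computable.unpair.comp Computable.snd)
      refine Partrec.nat_rec hu2 (hF.comp Computable.fst hu1)
        (h := fun x z => H x.1 (Nat.pair x.2.unpair.1 (Nat.pair z.1 z.2)))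
        (hH.comp (Computable.fst.comp Computable.fst) ?_)
      exact Primrec₂.natPair.to_comp.comp (hu1.comp Computable.fst)
        (Primrec₂.natPair.to_comp.comp (Computable.fst.comp Computable.snd)
          (Computable.snd.comp Computable.snd))
    · intro σ τ p y hst
      exact mono _ _ _ _ _ hst
    · intro p y
      change y ∈ (Nat.rec (f p.unpair.1) (fun y IH => IH.bind fun i =>
          h (Nat.pair p.unpair.1 (Nat.pair y i))) p.unpair.2 : Part ℕ) ↔
        ∃ s, y ∈ (Nat.rec (F (initSeg A s) p.unpair.1) (fun y IH => IH.bind fun i =>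
          H (initSeg A s) (Nat.pair p.unpair.1 (Nat.pair y i))) p.unpair.2 : Part ℕ)
      generalize p.unpair.2 = n
      generalize p.unpair.1 = a
      induction n generalizing y with
      | zero => exact eF _ _
      | succ n ih =>
        refine Part.mem_bind_iff.trans ?_
        simp only [Part.mem_bind_iff]
        constructor
        · rintro ⟨i, hi, hy⟩
          obtain ⟨s, hs⟩ := (ih _).1 hi
          obtain ⟨t, ht⟩ := (eH _ _).1 hy
          exact ⟨max s t, i, mono _ _ _ _ _ (initSeg_prefix A (le_max_left _ _)) hs,
            mH _ _ _ _ (initSeg_prefix A (le_max_right _ _)) ht⟩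
        · rintro ⟨s, i, hi, hy⟩
          exact ⟨i, (ih _).2 ⟨s, hi⟩, (eH _ _).2 ⟨s, hy⟩⟩
  | @rfind f _ ihf =>
    obtain ⟨F, hF, mF, eF⟩ := ihf
    have hmem : ∀ (g : ℕ → Part ℕ) (y : ℕ),
        y ∈ Nat.rfind (fun n => (g n).map fun m => decide (m = 0)) ↔
          0 ∈ g y ∧ ∀ m < y, ∃ z ∈ g m, z ≠ 0 := by
      intro g y
      refine Nat.mem_rfind.trans (and_congr ?_ (forall₂_congr fun m _ => ?_)) <;>
      · refine (Part.mem_map_iff _).trans ?_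
        simp
    refine ⟨fun σ a => Nat.rfind fun n => (F σ (Nat.pair a n)).map fun m => decide (m = 0),
      ?_, ?_, ?_⟩
    · refine Partrec.rfind (Partrec.map (hF.comp (Computable.fst.comp Computable.fst)
        (Primrec₂.natPair.to_comp.comp (Computable.snd.comp Computable.fst) Computable.snd)) ?_)
      exact (Primrec.eq.comp Primrec.snd (Primrec.const 0)).decide.to_comp
    · intro σ τ a y hst h
      refine (hmem _ _).2 ?_
      obtain ⟨h0, h⟩ := (hmem _ _).1 h
      refine ⟨mF _ _ _ _ hst h0, fun m hm => ?_⟩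
      obtain ⟨z, hz, hz0⟩ := h m hm
      exact ⟨z, mF _ _ _ _ hst hz, hz0⟩
    · intro a y
      refine (hmem _ _).trans (Iff.trans ?_ (exists_congr fun s => (hmem _ _).symm))
      constructor
      · rintro ⟨h0, h⟩
        obtain ⟨s, hs⟩ := (eF _ _).1 h0
        -- The search consults finitely many values before `y`; the supremum of their uses serves
        -- for all of them.
        have h' : ∀ m, ∃ t, m < y → ∃ z ∈ F (initSeg A t) (Nat.pair a m), z ≠ 0 := by
          intro m
          by_cases hm : m < y
          · obtain ⟨z, hz, hz0⟩ := h m hm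
            obtain ⟨t, ht⟩ := (eF _ _).1 hz
            exact ⟨t, fun _ => ⟨z, ht, hz0⟩⟩
          · exact ⟨0, fun h => absurd h hm⟩
        choose t ht using h'
        refine ⟨max s ((Finset.range y).sup t),
          mF _ _ _ _ (initSeg_prefix A (le_max_left _ _)) hs, fun m hm => ?_⟩
        obtain ⟨z, hz, hz0⟩ := ht m hm
        refine ⟨z, mF _ _ _ _ (initSeg_prefix A (le_trans ?_ (le_max_right _ _))) hz, hz0⟩
        exact Finset.le_sup (f := t) (Finset.mem_range.2 hm)
      · rintro ⟨s, h0, h⟩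
        refine ⟨(eF _ _).2 ⟨s, h0⟩, fun m hm => ?_⟩
        obtain ⟨z, hz, hz0⟩ := h m hm
        exact ⟨z, (eF _ _).2 ⟨s, hz⟩, hz0⟩

end Use

/-! ### Relative enumerability and Post's theorem -/

section RelativeRE

variable {α β : Type*} [Primcodable α] [Primcodable β] {A B : Set ℕ}

theorem recursiveIn_of_initSeg {g : ℕ → List Bool → ℕ} (hg : Primrec₂ g) :
    Nat.RecursiveIn {oracle A} fun m => Part.some (g m.unpair.1 (initSeg A m.unpair.2)) := by
  have h1 : Nat.Primrec fun m : ℕ =>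
      g m.unpair.1 ((Encodable.decode (α := List Bool) m.unpair.2).getD []) :=
    Primrec.nat_iff.1 (hg.comp (Primrec.fst.comp Primrec.unpair)
      (Primrec.option_getD.comp (Primrec.decode.comp (Primrec.snd.comp Primrec.unpair))
        (Primrec.const [])))
  refine (h1.recursiveIn.comp (.pair .left ((recursiveIn_initSeg A).comp .right))).of_eq
    fun m => ?_
  simp [Seq.seq]

theorem recursiveIn_search {T : List Bool → ℕ → Prop} [DecidableRel T] (hT : PrimrecRel T) :
    Nat.RecursiveIn {oracle A} fun n =>
      Nat.rfind ((fun s => decide (T (initSeg A s) n) : ℕ → Bool) : ℕ →. Bool) := by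
  have hg : Primrec₂ fun (n : ℕ) (σ : List Bool) => if T σ n then 0 else 1 :=
    Primrec.ite hT.swap (Primrec.const 0) (Primrec.const 1)
  refine (Nat.RecursiveIn.rfind (recursiveIn_of_initSeg (A := A) hg)).of_eq fun n => ?_
  congr 1
  funext s
  by_cases h : T (initSeg A s) n <;> simp [h]

theorem mem_search {T : List Bool → ℕ → Prop} [DecidableRel T] {n s : ℕ}
    (h : s ∈ Nat.rfind ((fun s => decide (T (initSeg A s) n) : ℕ → Bool) : ℕ →. Bool)) :
    T (initSeg A s) n := by
  simpa using Nat.rfind_spec h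

theorem search_dom {T : List Bool → ℕ → Prop} [DecidableRel T] {n s : ℕ}
    (h : T (initSeg A s) n) :
    (Nat.rfind ((fun s => decide (T (initSeg A s) n) : ℕ → Bool) : ℕ →. Bool)).Dom :=
  Nat.rfind_dom.2 ⟨s, by simpa using h, fun _ => trivial⟩

/-- Monotone primitive recursive stages for an r.e. predicate of initial segments. -/
theorem exists_primrecRel_of_rePred {R : List Bool → α → Prop}
    (hR : REPred fun x : List Bool × α => R x.1 x.2) :
    ∃ T : List Bool → α → Prop, PrimrecRel T ∧ (∀ σ τ a, σ <+: τ → T σ a → T τ a) ∧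
      ∀ a, (∃ s, R (initSeg A s) a) ↔ ∃ s, T (initSeg A s) a := by
  obtain ⟨S, hS, mS, eS⟩ := REPred.exists_stages hR
  -- The length of `σ` doubles as the stage bound, and all prefixes of `σ` are tried; this forces
  -- monotonicity even if `R` has none.
  refine ⟨fun σ a => ∃ t < σ.length + 1, S σ.length (σ.take t, a), ?_, ?_, fun a => ⟨?_, ?_⟩⟩
  · have h : PrimrecRel fun (t : ℕ) (x : List Bool × α) => S x.1.length (x.1.take t, x.2) :=
      hS.comp (Primrec.list_length.comp (Primrec.fst.comp Primrec.snd))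
        ((Primrec.list_take.comp Primrec.fst (Primrec.fst.comp Primrec.snd)).pair
          (Primrec.snd.comp Primrec.snd))
    refine PrimrecPred.of_eq (PrimrecRel.comp h.exists_mem_list (Primrec.list_range.comp
      (Primrec.succ.comp (Primrec.list_length.comp Primrec.fst))) Primrec.id) fun x => ?_
    simp
  · rintro σ _ a ⟨ρ, rfl⟩ ⟨t, ht, h⟩
    refine ⟨t, by simp; omega, ?_⟩
    rw [List.take_append_of_le_length (by omega)]
    exact mS _ _ _ (by simp) h
  · rintro ⟨s, hs⟩
    obtain ⟨k, hk⟩ := (eS (initSeg A s, a)).1 hs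
    refine ⟨max s k, s, by simp, ?_⟩
    rw [take_initSeg A (le_max_left _ _), length_initSeg]
    exact mS _ _ _ (le_max_right _ _) hk
  · rintro ⟨s, t, ht, h⟩
    rw [length_initSeg] at ht h
    rw [take_initSeg A (by omega)] at h
    exact ⟨t, (eS (initSeg A t, a)).2 ⟨_, h⟩⟩

theorem rePredIn_of_initSeg {R : List Bool → α → Prop}
    (hR : REPred fun x : List Bool × α => R x.1 x.2) :
    REPredIn A fun a => ∃ s, R (initSeg A s) a := by
  classical
  obtain ⟨T, hT, -, h⟩ := exists_primrecRel_of_rePred (A := A) hR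
  obtain ⟨T', hT', eT'⟩ : ∃ T' : List Bool → ℕ → Prop, PrimrecRel T' ∧
      ∀ σ n, T' σ n ↔ ∃ a, Encodable.decode (α := α) n = some a ∧ T σ a := by
    refine ⟨fun σ n => ∃ a ∈ (Encodable.decode (α := α) n).toList, Function.swap T a σ,
      (PrimrecRel.exists_mem_list hT.swap).comp
      (Primrec.optionToList.comp (Primrec.decode.comp Primrec.snd)) Primrec.fst, fun σ n => ?_⟩
    simp [Function.swap]
  refine ((Nat.Primrec.recursiveIn (.const 0)).comp (recursiveIn_search (A := A) hT')).of_eq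
    fun n => Part.ext fun y => ?_
  refine Part.mem_bind_iff.trans (Iff.trans ?_ Part.mem_bind_iff.symm)
  constructor
  · rintro ⟨s, hs, hy⟩
    obtain ⟨a, ha, hT⟩ := (eT' _ _).1 (mem_search hs)
    refine ⟨a, Part.mem_coe.2 ha, (Part.mem_map_iff _).2
      ⟨(), Part.mem_assert_iff.2 ⟨(h a).2 ⟨s, hT⟩, Part.mem_some _⟩, ?_⟩⟩
    exact (Part.mem_some_iff.1 hy).symm
  · rintro ⟨a, ha, hy⟩
    obtain ⟨_, hu, rfl⟩ := (Part.mem_map_iff _).1 hy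
    obtain ⟨hp, -⟩ := Part.mem_assert_iff.1 hu
    obtain ⟨s, hs⟩ := (h a).1 hp
    obtain ⟨t, ht⟩ := Part.dom_iff_mem.1
      (search_dom ((eT' (initSeg A s) n).2 ⟨a, Part.mem_coe.1 ha, hs⟩))
    exact ⟨t, ht, Part.mem_some _⟩

theorem REPredIn.of_eq {p q : α → Prop} (hp : REPredIn A p) (h : ∀ a, p a ↔ q a) :
    REPredIn A q :=
  (funext fun a => propext (h a) : p = q) ▸ hp

theorem REPredIn.exists_rePred {p : α → Prop} (hp : REPredIn A p) :
    ∃ R : List Bool → α → Prop, REPred (fun x : List Bool × α => R x.1 x.2) ∧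
      ∀ a, p a ↔ ∃ s, R (initSeg A s) a := by
  obtain ⟨F, hF, -, eF⟩ := exists_functional A hp
  refine ⟨fun σ a => (F σ (Encodable.encode a)).Dom,
    (hF.comp Computable.fst (Computable.encode.comp Computable.snd)).dom_re, fun a => ?_⟩
  simp only [Part.dom_iff_mem]
  rw [exists_comm]
  simp only [← eF]
  simp

theorem REPredIn.exists_primrecRel {p : α → Prop} (hp : REPredIn A p) :
    ∃ T : List Bool → α → Prop, PrimrecRel T ∧ (∀ σ τ a, σ <+: τ → T σ a → T τ a) ∧
      ∀ a, p a ↔ ∃ s, T (initSeg A s) a := by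
  obtain ⟨R, hR, h⟩ := hp.exists_rePred
  simp only [h]
  exact exists_primrecRel_of_rePred hR

theorem REPredIn.comp {p : β → Prop} (hp : REPredIn A p) {f : α → β} (hf : Computable f) :
    REPredIn A fun a => p (f a) := by
  obtain ⟨R, hR, h⟩ := hp.exists_rePred
  refine (rePredIn_of_initSeg (R := fun σ a => R σ (f a)) (rePred_comp hR
    (Computable.fst.pair (hf.comp Computable.snd)))).of_eq fun a => (h _).symm

theorem REPredIn.or {p q : α → Prop} (hp : REPredIn A p) (hq : REPredIn A q) :
    REPredIn A fun a => p a ∨ q a := by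
  obtain ⟨R, hR, h⟩ := hp.exists_rePred
  obtain ⟨S, hS, h'⟩ := hq.exists_rePred
  refine (rePredIn_of_initSeg (R := fun σ a => R σ a ∨ S σ a) (rePred_or hR hS)).of_eq fun a => ?_
  rw [h, h', exists_or]

theorem rePredIn_of_rePred {p : α → Prop} (hp : REPred p) : REPredIn A p :=
  Partrec.recursiveIn hp

theorem rePredIn_empty_iff {p : α → Prop} : REPredIn ∅ p ↔ REPred p := by
  refine ⟨fun h => RecursiveIn.partrec_of_const (s := Part.some 0) ?_, rePredIn_of_rePred⟩
  have : oracle ∅ = fun _ => Part.some 0 := by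
    funext n; simp [oracle]
  rwa [REPredIn, this] at h

/-- Post's theorem, relativized: a set is recursive in `A` iff it and its complement are
r.e. in `A`. -/
theorem turingLE_iff :
    TuringLE B A ↔ REPredIn A (· ∈ B) ∧ REPredIn A (· ∉ B) := by
  classical
  constructor
  · intro h
    obtain ⟨F, hF, -, eF⟩ := exists_functional A (RecursiveIn.iff_nat.1 h)
    have key : ∀ y, REPredIn A fun n => y ∈ oracle B n := fun y => by
      have hy : REPred fun x : List Bool × ℕ => y ∈ F x.1 x.2 := by
        have h1 : Partrec fun x : List Bool × ℕ => (F x.1 x.2).bind fun z =>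
            (Part.assert (z = y) fun _ => Part.some ()) :=
          Partrec.bind hF ((rePred_of_primrec (Primrec.eq.comp Primrec.id
            (Primrec.const y))).comp Computable.snd)
        refine h1.dom_re.of_eq fun x => ?_
        simp [Part.dom_iff_mem]
      exact (rePredIn_of_initSeg (R := fun σ n => y ∈ F σ n) hy).of_eq fun n => (eF n y).symm
    refine ⟨(key 1).of_eq fun n => Part.mem_some_iff.trans ?_,
      (key 0).of_eq fun n => Part.mem_some_iff.trans ?_⟩ <;>
    by_cases hn : n ∈ B <;> simp [hn]
  · rintro ⟨h1, h2⟩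
    obtain ⟨T, hT, -, e1⟩ := h1.exists_primrecRel
    obtain ⟨S, hS, -, e2⟩ := h2.exists_primrecRel
    -- Search for an initial segment that confirms `n ∈ B` or `n ∉ B`, then read off which one it
    -- confirmed.
    have hTS : PrimrecRel fun σ n => T σ n ∨ S σ n := PrimrecPred.or hT hS
    have hg : Primrec₂ fun (n : ℕ) (σ : List Bool) => if T σ n then 1 else 0 :=
      Primrec.ite hT.swap (Primrec.const 1) (Primrec.const 0)
    refine RecursiveIn.iff_nat.2 (((recursiveIn_of_initSeg (A := A) hg).comp
      (.pair (Nat.Primrec.id).recursiveIn (recursiveIn_search hTS))).of_eq fun n => ?_)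
    have hdom : ∃ s, T (initSeg A s) n ∨ S (initSeg A s) n := by
      rw [exists_or, ← e1, ← e2]; exact Classical.em _
    obtain ⟨s, hs⟩ := hdom
    obtain ⟨t, ht⟩ := Part.dom_iff_mem.1
      (search_dom (T := fun σ n => T σ n ∨ S σ n) hs)
    have hval := Part.eq_some_iff.2 ht
    change Part.bind (Nat.pair <$> Part.some n <*> _) _ = _
    rw [hval]
    simp only [Part.map_eq_map, Part.map_some, Seq.seq, Part.bind_some, Nat.unpair_pair, oracle]
    have hts := mem_search (T := fun σ n => T σ n ∨ S σ n) ht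
    by_cases hT' : T (initSeg A t) n
    · have : n ∈ B := (e1 n).2 ⟨t, hT'⟩
      simp [hT', this]
    · have : n ∉ B := (e2 n).2 ⟨t, hts.resolve_left hT'⟩
      simp [hT', this]

end RelativeRE

/-! ### The jump and the level `Σ⁰₂` relative to an oracle -/

section Jump

variable {α β : Type*} [Primcodable α] [Primcodable β] {A : Set ℕ}

theorem rePredIn_mem_jump (A : Set ℕ) : REPredIn A (· ∈ jump A) := by
  refine rePredIn_of_initSeg (A := A) (R := fun σ e => ((Denumerable.ofNat Nat.Partrec.Code e).eval
    (Nat.pair e (Encodable.encode σ))).Dom) ?_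
  exact (Nat.Partrec.Code.eval_part.comp ((Computable.ofNat _).comp Computable.snd)
    (Primrec₂.natPair.to_comp.comp Computable.snd
      (Computable.encode.comp Computable.fst))).dom_re

/-- The jump of `A` is many-one complete among the predicates r.e. in `A`. -/
theorem REPredIn.exists_reduction_jump {p : α → Prop} (hp : REPredIn A p) :
    ∃ f : α → ℕ, Primrec f ∧ ∀ a, p a ↔ f a ∈ jump A := by
  obtain ⟨R, hR, h⟩ := hp.exists_rePred
  -- Here `m` codes a triple: `a`, the diagonal argument of the jump (ignored), and the oracle
  -- string. Currying in `a` gives the reduction.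
  have hq : REPred fun m : ℕ => ∃ x : List Bool × α,
      (Encodable.encode x.2 = m.unpair.1 ∧ Encodable.encode x.1 = m.unpair.2.unpair.2) ∧
        R x.1 x.2 := by
    refine rePred_exists (rePred_and (rePred_of_primrec (PrimrecPred.and ?_ ?_))
      (rePred_comp hR Computable.snd))
    · exact Primrec.eq.comp (Primrec.encode.comp (Primrec.snd.comp Primrec.snd))
        (Primrec.fst.comp (Primrec.unpair.comp Primrec.fst))
    · exact Primrec.eq.comp (Primrec.encode.comp (Primrec.fst.comp Primrec.snd))
        (Primrec.snd.comp (Primrec.unpair.comp (Primrec.snd.comp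
          (Primrec.unpair.comp Primrec.fst))))
  obtain ⟨c, hc⟩ := REPred.exists_code hq
  refine ⟨fun a => Encodable.encode (c.curry (Encodable.encode a)), ?_, fun a => ?_⟩
  · exact Primrec.encode.comp (Nat.Partrec.Code.primrec₂_curry.comp (Primrec.const c)
      Primrec.encode)
  · rw [h]
    refine exists_congr fun s => ?_
    rw [Denumerable.ofNat_encode, Nat.Partrec.Code.eval_curry]
    have hcm := hc (Nat.pair (Encodable.encode a) (Nat.pair
      (Encodable.encode (c.curry (Encodable.encode a))) (Encodable.encode (initSeg A s))))
    rw [Encodable.encode_nat] at hcm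
    rw [← hcm]
    simp

/-- A predicate is r.e. in the jump of `A` if it is `Σ⁰₂` relative to `A`. -/
theorem rePredIn_jump_of_exists_not {q : α → β → Prop}
    (hq : REPredIn A fun x : α × β => q x.1 x.2) :
    REPredIn (jump A) fun a => ∃ b, ¬ q a b := by
  obtain ⟨f, hf, hfq⟩ := hq.exists_reduction_jump
  refine (rePredIn_of_initSeg (A := jump A)
    (R := fun σ a => ∃ b, σ[f (a, b)]? = some false) ?_).of_eq fun a => ?_
  · refine rePred_exists (rePred_of_primrec (Primrec.eq.comp (Primrec.list_getElem?.comp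
      (Primrec.fst.comp Primrec.fst) (hf.comp ?_)) (Primrec.const _)))
    exact (Primrec.snd.comp Primrec.fst).pair Primrec.snd
  · rw [exists_comm]
    refine exists_congr fun b => ?_
    simp only [getElem?_initSeg_eq_some, hfq (a, b)]
    exact ⟨fun ⟨_, _, h⟩ => by simpa using h, fun h => ⟨_, Nat.lt_succ_self _, by simpa using h⟩⟩

/-- A predicate that is r.e. in the jump of `A` is `Σ⁰₂` relative to `A`. -/
theorem REPredIn.exists_not_of_jump {p : α → Prop} (hp : REPredIn (jump A) p) :
    ∃ q : α → ℕ → Prop, REPredIn A (fun x : α × ℕ => q x.1 x.2) ∧ ∀ a, p a ↔ ∃ n, ¬ q a n := by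
  obtain ⟨R, hR, mR, eR⟩ := hp.exists_primrecRel
  obtain ⟨W, hW, mW, eW⟩ := (rePredIn_mem_jump A).exists_primrecRel
  -- the initial segment `τ` of `A` refutes that `σ` is an initial segment of the jump with
  -- `R σ a`, the positive part of `σ` being enumerated from the initial segment `ρ`
  let Θ : List Bool → α → List Bool × List Bool → Prop := fun τ a x =>
    -- The length condition keeps a `τ` that is merely too short from counting as a refutation of
    -- `ρ`.
    x.2.length ≤ τ.length ∧ (¬ x.2 <+: τ ∨ ¬ R x.1 a ∨
      ∃ i : ℕ, (x.1[i]? = some true ∧ ¬ W x.2 i) ∨ (x.1[i]? = some false ∧ W τ i))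
  let Q : List Bool → α × ℕ → Prop := fun τ y =>
    -- Numbers that code no pair count as refuted, so they are never witnesses.
    Encodable.decode (α := List Bool × List Bool) y.2 = none ∨
      ∃ x : List Bool × List Bool, Encodable.decode y.2 = some x ∧ Θ τ y.1 x
  have hΘ : REPred fun z : (List Bool × α) × (List Bool × List Bool) => Θ z.1.1 z.1.2 z.2 := by
    have hτ : Primrec fun z : (List Bool × α) × (List Bool × List Bool) => z.1.1 :=
      Primrec.fst.comp Primrec.fst
    have ha : Primrec fun z : (List Bool × α) × (List Bool × List Bool) => z.1.2 :=
      Primrec.snd.comp Primrec.fst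
    have hσ : Primrec fun z : (List Bool × α) × (List Bool × List Bool) => z.2.1 :=
      Primrec.fst.comp Primrec.snd
    have hρ : Primrec fun z : (List Bool × α) × (List Bool × List Bool) => z.2.2 :=
      Primrec.snd.comp Primrec.snd
    refine rePred_and (rePred_of_primrec (Primrec.nat_le.comp (Primrec.list_length.comp hρ)
      (Primrec.list_length.comp hτ))) (rePred_or (rePred_of_primrec
        (primrecRel_prefix.comp hρ hτ).not) (rePred_or (rePred_of_primrec (hR.comp hσ ha).not)
          (rePred_exists (rePred_of_primrec (PrimrecPred.or (PrimrecPred.and ?_ ?_)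
            (PrimrecPred.and ?_ ?_))))))
    · exact Primrec.eq.comp (Primrec.list_getElem?.comp (hσ.comp Primrec.fst) Primrec.snd)
        (Primrec.const _)
    · exact (hW.comp (hρ.comp Primrec.fst) Primrec.snd).not
    · exact Primrec.eq.comp (Primrec.list_getElem?.comp (hσ.comp Primrec.fst) Primrec.snd)
        (Primrec.const _)
    · exact hW.comp (hτ.comp Primrec.fst) Primrec.snd
  have hQ : REPred fun z : List Bool × (α × ℕ) => Q z.1 z.2 := by
    have hdec : Primrec fun z : List Bool × (α × ℕ) =>
        Encodable.decode (α := List Bool × List Bool) z.2.2 :=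
      Primrec.decode.comp (Primrec.snd.comp Primrec.snd)
    have hΘ' : REPred fun z : (List Bool × (α × ℕ)) × (List Bool × List Bool) =>
        Θ z.1.1 z.1.2.1 z.2 :=
      rePred_comp (f := fun z : (List Bool × (α × ℕ)) × (List Bool × List Bool) =>
        ((z.1.1, z.1.2.1), z.2)) hΘ (((Computable.fst.comp Computable.fst).pair
          (Computable.fst.comp (Computable.snd.comp Computable.fst))).pair Computable.snd)
    exact rePred_or (rePred_of_primrec (Primrec.eq.comp hdec (Primrec.const _)))
      (rePred_exists (rePred_and (rePred_of_primrec (Primrec.eq.comp (hdec.comp Primrec.fst)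
        (Primrec.option_some.comp Primrec.snd))) hΘ'))
  refine ⟨fun a n => ∃ s, Q (initSeg A s) (a, n), rePredIn_of_initSeg hQ, fun a => ?_⟩
  rw [eR]
  constructor
  · rintro ⟨s, hs⟩
    have h' : ∀ i, ∃ t, i ∈ jump A → W (initSeg A t) i := fun i => by
      by_cases hi : i ∈ jump A
      · obtain ⟨t, ht⟩ := (eW i).1 hi
        exact ⟨t, fun _ => ht⟩
      · exact ⟨0, fun h => absurd h hi⟩
    choose t ht using h'
    -- The second string is long enough to enumerate every element of the jump below `s`.
    refine ⟨Encodable.encode (initSeg (jump A) s, initSeg A ((Finset.range s).sup t)), ?_⟩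
    rintro ⟨u, hu | ⟨x, hx, hlen, hu⟩⟩
    · simp at hu
    · simp only [Encodable.encodek, Option.some.injEq] at hx
      subst hx
      simp only [length_initSeg] at hlen
      obtain h | h | ⟨i, ⟨hi, h⟩ | ⟨hi, h⟩⟩ := hu
      · exact h (initSeg_prefix A hlen)
      · exact h hs
      · obtain ⟨his, hi⟩ := (getElem?_initSeg_eq_some _).1 hi
        exact h (mW _ _ _ (initSeg_prefix A (Finset.le_sup (f := t) (Finset.mem_range.2 his)))
          (ht i (hi.1 rfl)))
      · obtain ⟨-, hi⟩ := (getElem?_initSeg_eq_some _).1 hi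
        simpa using hi.2 ((eW i).2 ⟨u, h⟩)
  · rintro ⟨n, hn⟩
    rw [not_exists] at hn
    cases hx : Encodable.decode (α := List Bool × List Bool) n with
    | none => exact absurd (Or.inl hx) (hn 0)
    | some x =>
      obtain ⟨σ, ρ⟩ := x
      have hn' : ∀ u, ρ.length ≤ u → ρ <+: initSeg A u ∧ R σ a ∧ ∀ i : ℕ,
          (σ[i]? = some true → W ρ i) ∧ (σ[i]? = some false → ¬ W (initSeg A u) i) := by
        intro u hu
        by_contra hcon
        refine hn u (Or.inr ⟨_, hx, by simpa using hu, ?_⟩)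
        by_contra hcon'
        refine hcon ?_
        simp only [not_or, not_not, not_exists, not_and] at hcon'
        exact hcon'
      have hρ := eq_initSeg_of_prefix A (hn' _ le_rfl).1
      refine ⟨σ.length, ?_⟩
      rw [← eq_initSeg (jump A) (σ := σ)]
      · exact (hn' _ le_rfl).2.1
      · intro i b hb
        cases b with
        | true =>
          have := ((hn' _ le_rfl).2.2 i).1 hb
          rw [hρ] at this
          simpa using (eW i).2 ⟨_, this⟩
        | false =>
          simp only [Bool.false_eq_true, false_iff, eW, not_exists]
          intro u hu
          refine ((hn' (max u ρ.length) (le_max_right _ _)).2.2 i).2 hb ?_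
          exact mW _ _ _ (initSeg_prefix A (le_max_left _ _)) hu

end Jump

/-! ### Cantor space -/

section Cantor

/-- The point of Cantor space that extends `σ` by zeros. -/
def extendZero (σ : List Bool) : ℕ → Bool := fun i => σ.getD i false

theorem mem_cyl_iff {σ : List Bool} {x : ℕ → Bool} :
    x ∈ cyl σ ↔ ∀ i b, σ[i]? = some b → x i = b := by
  constructor
  · intro h i b hb
    obtain ⟨hi, rfl⟩ := List.getElem?_eq_some_iff.1 hb
    exact h i hi
  · intro h i hi
    exact h i _ (List.getElem?_eq_getElem hi)

theorem extendZero_mem_cyl (σ : List Bool) : extendZero σ ∈ cyl σ :=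
  mem_cyl_iff.2 fun i b hb => by simp [extendZero, hb]

theorem cyl_subset_cyl {σ τ : List Bool} (h : σ <+: τ) : cyl τ ⊆ cyl σ := by
  obtain ⟨ρ, rfl⟩ := h
  intro x hx
  rw [mem_cyl_iff] at hx ⊢
  intro i b hb
  obtain ⟨hi, -⟩ := List.getElem?_eq_some_iff.1 hb
  exact hx i b (by rw [List.getElem?_append_left hi, hb])

theorem eq_map_of_mem_cyl {σ : List Bool} {x : ℕ → Bool} (h : x ∈ cyl σ) :
    σ = (List.range σ.length).map x :=
  List.ext_getElem (by simp) fun i hi _ => by simp [h i hi]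

theorem mem_cyl_map_range (x : ℕ → Bool) (n : ℕ) : x ∈ cyl ((List.range n).map x) := by
  intro i hi
  simp

theorem prefix_or_prefix_of_mem_cyl {σ τ : List Bool} {x : ℕ → Bool} (hσ : x ∈ cyl σ)
    (hτ : x ∈ cyl τ) : σ <+: τ ∨ τ <+: σ := by
  have key : ∀ m n, m ≤ n → (List.range m).map x <+: (List.range n).map x := by
    intro m n h
    obtain ⟨k, rfl⟩ := Nat.exists_eq_add_of_le h
    rw [List.range_add, List.map_append]
    exact List.prefix_append _ _
  rw [eq_map_of_mem_cyl hσ, eq_map_of_mem_cyl hτ]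
  exact (le_total _ _).imp (key _ _) (key _ _)

theorem isOpen_cyl (σ : List Bool) : IsOpen (cyl σ) := by
  have : cyl σ = ⋂ i : Fin σ.length, (fun x : ℕ → Bool => x i) ⁻¹' {σ[i]} := by
    ext x
    simp [cyl, Fin.forall_iff]
  rw [this]
  exact isOpen_iInter_of_finite fun i => (isOpen_discrete _).preimage (continuous_apply _)

theorem exists_cyl_subset {U : Set (ℕ → Bool)} (hU : IsOpen U) {x : ℕ → Bool} (hx : x ∈ U) :
    ∃ σ, x ∈ cyl σ ∧ cyl σ ⊆ U := by
  obtain ⟨I, u, hu, hsub⟩ := isOpen_pi_iff.1 hU x hx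
  refine ⟨(List.range (I.sup id + 1)).map x, mem_cyl_map_range _ _, fun y hy => hsub ?_⟩
  intro i hi
  have hlt : i < I.sup id + 1 := Nat.lt_succ_of_le (Finset.le_sup (f := id) hi)
  have : y i = x i := by
    have := hy i (by simpa using hlt)
    simpa using this
  rw [this]
  exact (hu i hi).2

theorem isClosed_of_compl_eq {P : Set (ℕ → Bool)} {W : List Bool → Prop}
    (h : Pᶜ = ⋃ σ ∈ {σ | W σ}, cyl σ) : IsClosed P := by
  rw [← isOpen_compl_iff, h]
  exact isOpen_biUnion fun σ _ => isOpen_cyl σ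

/-- A closed class given by the set `W` of strings removed from it is nowhere dense iff every
string is compatible with a removed one. -/
theorem isNowhereDense_iff {P : Set (ℕ → Bool)} {W : List Bool → Prop}
    (h : Pᶜ = ⋃ σ ∈ {σ | W σ}, cyl σ) :
    IsNowhereDense P ↔ ∀ σ, ∃ τ, W τ ∧ (τ <+: σ ∨ σ <+: τ) := by
  have hmem : ∀ x, x ∉ P ↔ ∃ τ, W τ ∧ x ∈ cyl τ := fun x => by
    rw [← Set.mem_compl_iff, h]; simp
  rw [(isClosed_of_compl_eq h).isNowhereDense_iff]
  constructor
  · intro hP σ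
    by_contra! hcon
    have : cyl σ ⊆ interior P := by
      refine interior_maximal (fun x hx => ?_) (isOpen_cyl σ)
      by_contra hxP
      obtain ⟨τ, hτ, hxτ⟩ := (hmem x).1 hxP
      obtain h | h := prefix_or_prefix_of_mem_cyl hxτ hx
      · exact (hcon τ hτ).1 h
      · exact (hcon τ hτ).2 h
    rw [hP] at this
    exact this (extendZero_mem_cyl σ)
  · intro hW
    refine Set.eq_empty_of_forall_notMem fun x hx => ?_
    obtain ⟨σ, -, hσ⟩ := exists_cyl_subset isOpen_interior hx
    replace hσ := hσ.trans interior_subset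
    obtain ⟨τ, hτ, hc | hc⟩ := hW σ
    · exact (hmem _).2 ⟨τ, hτ, cyl_subset_cyl hc (extendZero_mem_cyl σ)⟩
        (hσ (extendZero_mem_cyl σ))
    · exact (hmem _).2 ⟨τ, hτ, extendZero_mem_cyl τ⟩
        (hσ (cyl_subset_cyl hc (extendZero_mem_cyl τ)))

end Cantor

/-! ### High oracles list the nowhere dense classes -/

/-- A false guess `⟨e, n⟩` is harmless: it is eventually exposed, and the class then becomes empty.
-/
theorem High.exists_listing {A : Set ℕ} (hA : High A) :
    ∃ G : ℕ → Set (ℕ → Bool), IsUniformPi01 A G ∧ (∀ k, IsNowhereDense (G k)) ∧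
      ∀ P : Set (ℕ → Bool), IsPi01 ∅ P → IsNowhereDense P → ∃ k, G k = P := by
  let V : ℕ → List Bool → Prop := fun e σ =>
    ((Denumerable.ofNat Nat.Partrec.Code e).eval (Encodable.encode σ)).Dom
  have hV : REPred fun x : ℕ × List Bool => V x.1 x.2 :=
    (Nat.Partrec.Code.eval_part.comp ((Computable.ofNat _).comp Computable.fst)
      (Computable.encode.comp Computable.snd)).dom_re
  let dense : ℕ → List Bool → Prop := fun e σ => ∃ τ, V e τ ∧ (τ <+: σ ∨ σ <+: τ)
  have hdense : REPred fun x : ℕ × List Bool => dense x.1 x.2 := by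
    have h1 : REPred fun x : (ℕ × List Bool) × List Bool => V x.1.1 x.2 :=
      rePred_comp (f := fun x : (ℕ × List Bool) × List Bool => (x.1.1, x.2)) hV
        ((Computable.fst.comp Computable.fst).pair Computable.snd)
    exact rePred_exists (rePred_and h1 (rePred_of_primrec (PrimrecPred.or
      (primrecRel_prefix.comp Primrec.snd (Primrec.snd.comp Primrec.fst))
      (primrecRel_prefix.comp (Primrec.snd.comp Primrec.fst) Primrec.snd))))
  -- Failure of density is r.e. in `∅'`, hence reducible to `∅''`; highness makes the complement
  -- r.e. in the jump of `A`.
  obtain ⟨f, hf, hfJ⟩ := (rePredIn_jump_of_exists_not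
    (rePredIn_of_rePred (A := ∅) hdense)).exists_reduction_jump
  have hnd : REPredIn (jump A) fun e => ∀ σ, dense e σ :=
    ((turingLE_iff.1 hA).2.comp hf.to_comp).of_eq fun e => by
      rw [← hfJ]; simp
  obtain ⟨q, hq, hqnd⟩ := hnd.exists_not_of_jump
  let W : ℕ × List Bool → Prop := fun x =>
    V x.1.unpair.1 x.2 ∨ q x.1.unpair.1 x.1.unpair.2
  have hu : Computable fun x : ℕ × List Bool => x.1.unpair :=
    Computable.unpair.comp Computable.fst
  have hW : REPredIn A W :=
    ((rePredIn_of_rePred hV).comp (f := fun x : ℕ × List Bool => (x.1.unpair.1, x.2))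
      ((Computable.fst.comp hu).pair Computable.snd)).or (hq.comp hu)
  refine ⟨fun k => (⋃ σ ∈ {σ | W (k, σ)}, cyl σ)ᶜ, ⟨W, hW, fun k => compl_compl _⟩, fun k => ?_,
    fun P ⟨X, hX, hP⟩ hPnd => ?_⟩
  · refine (isNowhereDense_iff (W := fun σ => W (k, σ)) (compl_compl _)).2 fun σ => ?_
    by_cases hk : q k.unpair.1 k.unpair.2
    · exact ⟨σ, Or.inr hk, Or.inl List.prefix_rfl⟩
    · obtain ⟨τ, hτ, h⟩ := (hqnd _).2 ⟨_, hk⟩ σ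
      exact ⟨τ, Or.inl hτ, h⟩
  · obtain ⟨c, hc⟩ := REPred.exists_code (rePredIn_empty_iff.1 hX)
    have hVX : ∀ σ, V (Encodable.encode c) σ ↔ X σ := fun σ => by
      simp only [V, Denumerable.ofNat_encode]
      exact (hc σ).symm
    obtain ⟨n, hn⟩ := (hqnd (Encodable.encode c)).1 fun σ => by
      obtain ⟨τ, hτ, h⟩ := (isNowhereDense_iff hP).1 hPnd σ
      exact ⟨τ, (hVX τ).2 hτ, h⟩
    refine ⟨Nat.pair (Encodable.encode c) n, ?_⟩
    rw [compl_eq_comm, hP]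
    simp [W, hVX, hn]

theorem MeagerEngulfing.of_listing {A : Set ℕ} {G : ℕ → Set (ℕ → Bool)} (hG : IsUniformPi01 A G)
    (hnd : ∀ k, IsNowhereDense (G k))
    (hall : ∀ P : Set (ℕ → Bool), IsPi01 ∅ P → IsNowhereDense P → ∃ k, G k = P) :
    MeagerEngulfing A := by
  refine ⟨⋃ k, G k, ⟨G, hG, hnd, le_rfl⟩, fun F ⟨C, ⟨W, hW, hC⟩, hCnd, hF⟩ =>
    hF.trans (Set.iUnion_subset fun m => ?_)⟩
  obtain ⟨k, hk⟩ := hall (C m) ⟨fun σ => W (m, σ),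
    hW.comp (f := fun σ => (m, σ)) ((Computable.const m).pair Computable.id), hC m⟩ (hCnd m)
  exact hk ▸ Set.subset_iUnion G k

/-! ### Meager engulfing oracles are high -/

/-- A `Π⁰₂` predicate holds iff a uniformly primitive recursive set is infinite. -/
theorem exists_primrecRel_infinite {α : Type*} [Primcodable α] {q : α → ℕ → Prop}
    (hq : REPred fun x : α × ℕ => q x.1 x.2) :
    ∃ U : α → ℕ → Prop, PrimrecRel U ∧ ∀ a, (∀ n, q a n) ↔ {s | U a s}.Infinite := by
  obtain ⟨R, hR, mR, eR⟩ := REPred.exists_stages hq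
  -- By stage `k`, all of `q a 0, …, q a n` are confirmed. `U` collects the pairs `⟨n, k⟩` with `k`
  -- least, hence at most one for each `n`.
  let B : α → ℕ → ℕ → Prop := fun a n k => ∀ i < n + 1, R k (a, i)
  let U : α → ℕ → Prop := fun a s => B a s.unpair.1 s.unpair.2 ∧
    (s.unpair.2 = 0 ∨ ¬ B a s.unpair.1 (s.unpair.2 - 1))
  have hB : PrimrecPred fun x : α × ℕ × ℕ => B x.1 x.2.1 x.2.2 := by
    have h : PrimrecRel fun (i : ℕ) (x : α × ℕ × ℕ) => R x.2.2 (x.1, i) :=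
      hR.comp (Primrec.snd.comp (Primrec.snd.comp Primrec.snd))
        ((Primrec.fst.comp Primrec.snd).pair Primrec.fst)
    refine PrimrecPred.of_eq (PrimrecRel.comp h.forall_mem_list (Primrec.list_range.comp
      (Primrec.succ.comp (Primrec.fst.comp Primrec.snd))) Primrec.id) fun x => ?_
    simp [B]
  have mB : ∀ {a n k l}, k ≤ l → B a n k → B a n l := fun hkl h i hi => mR _ _ _ hkl (h i hi)
  have huniq : ∀ {a s t}, U a s → U a t → s.unpair.1 = t.unpair.1 →
      t.unpair.2 ≤ s.unpair.2 := by
    intro a s t hs ht hst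
    by_contra! hlt
    obtain h0 | h := ht.2
    · omega
    · exact h (mB (by omega) (hst ▸ hs.1))
  refine ⟨U, ?_, fun a => ⟨fun h => ?_, fun h n => ?_⟩⟩
  · have h1 : Primrec fun x : α × ℕ => x.2.unpair.1 :=
      Primrec.fst.comp (Primrec.unpair.comp Primrec.snd)
    have h2 : Primrec fun x : α × ℕ => x.2.unpair.2 :=
      Primrec.snd.comp (Primrec.unpair.comp Primrec.snd)
    exact PrimrecPred.and (hB.comp (Primrec.fst.pair (h1.pair h2)))
      (PrimrecPred.or (Primrec.eq.comp h2 (Primrec.const 0))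
        (hB.comp (Primrec.fst.pair (h1.pair (Primrec.pred.comp h2)))).not)
  · refine Set.infinite_of_forall_exists_gt fun n => ?_
    have hex : ∃ k, B a (n + 1) k := by
      choose k hk using fun i => (eR (a, i)).1 (h i)
      exact ⟨(Finset.range (n + 1 + 1)).sup k, fun i hi =>
        mR _ _ _ (Finset.le_sup (Finset.mem_range.2 hi)) (hk i)⟩
    classical
    refine ⟨Nat.pair (n + 1) (Nat.find hex), ?_, lt_of_lt_of_le n.lt_succ_self
      (Nat.left_le_pair _ _)⟩
    simp only [U, Set.mem_ofPred_eq, Nat.unpair_pair]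
    refine ⟨Nat.find_spec hex, or_iff_not_imp_left.2 fun h0 => Nat.find_min hex (by omega)⟩
  · by_contra hn
    -- If `q a n` fails, only first coordinates below `n` occur in `U`, each at most once.
    refine h ((Set.finite_Iio n).of_injOn (f := fun s => s.unpair.1) (fun s hs => ?_) ?_)
    · by_contra hlt
      exact hn ((eR (a, n)).2 ⟨_, hs.1 n (Nat.lt_succ_of_le (not_lt.1 hlt))⟩)
    · intro s hs t ht hst
      replace hst : s.unpair.1 = t.unpair.1 := hst
      rw [← Nat.pair_unpair s, ← Nat.pair_unpair t, hst,
        le_antisymm (huniq ht hs hst.symm) (huniq hs ht hst)]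

/-- The class of all points vanishing on `U`. -/
def vanishing (U : ℕ → Prop) : Set (ℕ → Bool) := {x | ∀ s, U s → x s = false}

/-- `σ` vanishes on `U`, that is, `σ` has an extension in `vanishing U`. -/
def Vanishes (U : ℕ → Prop) (σ : List Bool) : Prop := ∀ s, U s → σ[s]? ≠ some true

section Vanishing

variable {U : ℕ → Prop} {σ τ : List Bool}

theorem extendZero_mem_vanishing (h : Vanishes U σ) : extendZero σ ∈ vanishing U := by
  intro s hs
  have := h s hs
  simp only [extendZero, List.getD_eq_getElem?_getD]
  rcases hσ : σ[s]? with _ | _ | _ <;> simp_all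

theorem Vanishes.of_mem_cyl {x : ℕ → Bool} (hx : x ∈ vanishing U) (hσ : x ∈ cyl σ) :
    Vanishes U σ := by
  intro s hs h
  have h1 := mem_cyl_iff.1 hσ s _ h
  rw [hx s hs] at h1
  cases h1

theorem compl_vanishing (U : ℕ → Prop) :
    (vanishing U)ᶜ = ⋃ τ ∈ {τ : List Bool | ∃ s, U s ∧ τ[s]? = some true}, cyl τ := by
  ext x
  simp only [vanishing, Set.mem_compl_iff, Set.mem_ofPred_eq, not_forall, Set.mem_iUnion,
    Bool.not_eq_false]
  constructor
  · rintro ⟨s, hs, hx⟩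
    exact ⟨(List.range (s + 1)).map x, ⟨s, hs, by simp [hx]⟩, mem_cyl_map_range _ _⟩
  · rintro ⟨τ, ⟨s, hs, hτ⟩, hx⟩
    exact ⟨s, hs, mem_cyl_iff.1 hx s _ hτ⟩

/-- Any string can be extended by ones through an element of `U` beyond its length. -/
theorem isNowhereDense_vanishing (hU : {s | U s}.Infinite) : IsNowhereDense (vanishing U) := by
  refine (isNowhereDense_iff (compl_vanishing U)).2 fun σ => ?_
  obtain ⟨s, hs, hlt⟩ := hU.exists_gt σ.length
  refine ⟨σ ++ List.replicate (s + 1 - σ.length) true, ⟨s, hs, ?_⟩,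
    Or.inr (List.prefix_append _ _)⟩
  rw [List.getElem?_append_right hlt.le, List.getElem?_replicate, if_pos (by omega)]

theorem effectivelyMeager_vanishing (hU : PrimrecPred U) (hinf : {s | U s}.Infinite) :
    EffectivelyMeager ∅ (vanishing U) := by
  refine ⟨fun _ => vanishing U, ⟨fun x => ∃ s, U s ∧ x.2[s]? = some true, ?_,
    fun _ => compl_vanishing U⟩, fun _ => isNowhereDense_vanishing hinf,
    Set.subset_iUnion (fun _ : ℕ => vanishing U) 0⟩
  exact rePredIn_of_rePred (rePred_exists (rePred_of_primrec (PrimrecPred.and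
    (hU.comp Primrec.snd) (Primrec.eq.comp (Primrec.list_getElem?.comp
      (Primrec.snd.comp Primrec.fst) Primrec.snd) (Primrec.const _)))))

/-- Baire category theorem in the class `vanishing U`. -/
theorem exists_cyl_inter_vanishing_subset {C : ℕ → Set (ℕ → Bool)} (hC : ∀ m, IsClosed (C m))
    (hsub : vanishing U ⊆ ⋃ m, C m) :
    ∃ m σ, Vanishes U σ ∧ cyl σ ∩ vanishing U ⊆ C m := by
  have hcl : IsClosed (vanishing U) := isClosed_of_compl_eq (compl_vanishing U)
  have : CompactSpace (vanishing U) := isCompact_iff_compactSpace.1 hcl.isCompact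
  have : Nonempty (vanishing U) := ⟨⟨fun _ => false, fun _ _ => rfl⟩⟩
  obtain ⟨m, ⟨x, hx⟩, hxm⟩ := nonempty_interior_of_iUnion_of_closed
    (f := fun m => ((↑) : vanishing U → ℕ → Bool) ⁻¹' C m)
    (fun m => (hC m).preimage continuous_subtype_val)
    (by rw [← Set.preimage_iUnion]; exact Set.eq_univ_of_forall fun x => hsub x.2)
  obtain ⟨O, hO, hOeq⟩ := isOpen_induced_iff.1
    (isOpen_interior (s := ((↑) : vanishing U → ℕ → Bool) ⁻¹' C m))
  have hxO : x ∈ O := by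
    have : (⟨x, hx⟩ : vanishing U) ∈ ((↑) : vanishing U → ℕ → Bool) ⁻¹' O := hOeq ▸ hxm
    exact this
  obtain ⟨σ, hxσ, hσO⟩ := exists_cyl_subset hO hxO
  refine ⟨m, σ, .of_mem_cyl hx hxσ, fun y ⟨hyσ, hy⟩ => ?_⟩
  have hy' : (⟨y, hy⟩ : vanishing U) ∈ interior (((↑) : vanishing U → ℕ → Bool) ⁻¹' C m) :=
    hOeq ▸ hσO hyσ
  have : (⟨y, hy⟩ : vanishing U) ∈ ((↑) : vanishing U → ℕ → Bool) ⁻¹' C m := interior_subset hy'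
  exact this

/-- If `vanishing U` is covered when `U` is infinite, then infinity of `U` is witnessed by a
basic clopen set in which `vanishing U` is contained in one of the covering classes. -/
theorem infinite_iff_exists_not_escape {C : ℕ → Set (ℕ → Bool)} {W : ℕ × List Bool → Prop}
    (hW : ∀ m, (C m)ᶜ = ⋃ σ ∈ {σ | W (m, σ)}, cyl σ) (hC : ∀ m, IsNowhereDense (C m))
    (hsub : {s | U s}.Infinite → vanishing U ⊆ ⋃ m, C m) :
    {s | U s}.Infinite ↔ ∃ y : ℕ × List Bool, ¬ (¬ Vanishes U y.2 ∨
      ∃ z : List Bool × List Bool, ((y.2 <+: z.1 ∧ z.2 <+: z.1) ∧ Vanishes U z.1) ∧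
        W (y.1, z.2)) := by
  constructor
  · intro hinf
    obtain ⟨m, σ, hσ, h⟩ := exists_cyl_inter_vanishing_subset
      (fun m => isClosed_of_compl_eq (W := fun σ => W (m, σ)) (hW m)) (hsub hinf)
    refine ⟨(m, σ), ?_⟩
    rintro (hcon | ⟨⟨τ, ρ⟩, ⟨⟨hστ, hρτ⟩, hτ⟩, hρ⟩)
    · exact hcon hσ
    · have h1 := h ⟨cyl_subset_cyl hστ (extendZero_mem_cyl τ), extendZero_mem_vanishing hτ⟩
      have h2 : extendZero τ ∈ (C m)ᶜ := by
        rw [hW]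
        exact Set.mem_biUnion (x := ρ) hρ (cyl_subset_cyl hρτ (extendZero_mem_cyl τ))
      exact h2 h1
  · rintro ⟨⟨m, σ⟩, hy⟩ hfin
    simp only [not_or, not_not, not_exists] at hy
    obtain ⟨hσ, hy⟩ := hy
    obtain ⟨N, hN⟩ := hfin.bddAbove
    -- The `N + 1` zeros cover every position up to the bound `N` of `U` that `σ` leaves open, so
    -- all later bits are free and the density of the removed strings yields an escape.
    have hvan : ∀ τ, σ ++ List.replicate (N + 1) false <+: τ → Vanishes U τ := by
      rintro _ ⟨ρ, rfl⟩ s hs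
      have hsN : s ≤ N := hN hs
      by_cases hlt : s < σ.length
      · rw [List.append_assoc, List.getElem?_append_left hlt]
        exact hσ s hs
      · rw [List.getElem?_append_left (by simp; omega), List.getElem?_append_right (not_lt.1 hlt),
          List.getElem?_replicate, if_pos (by omega)]
        simp
    obtain ⟨ρ, hρ, hc | hc⟩ := (isNowhereDense_iff (W := fun σ => W (m, σ)) (hW m)).1 (hC m)
      (σ ++ List.replicate (N + 1) false)
    · exact hy (_, ρ) ⟨⟨⟨List.prefix_append _ _, hc⟩, hvan _ List.prefix_rfl⟩, hρ⟩
    · exact hy (ρ, ρ) ⟨⟨⟨(List.prefix_append _ _).trans hc, List.prefix_rfl⟩, hvan _ hc⟩, hρ⟩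

theorem primrecRel_vanishes {U : ℕ → ℕ → Prop} (hU : PrimrecRel U) :
    PrimrecRel fun e σ => Vanishes (U e) σ := by
  have h : PrimrecRel fun (s : ℕ) (x : ℕ × List Bool) => ¬ (U x.1 s ∧ x.2[s]? = some true) :=
    (PrimrecPred.and (hU.comp (Primrec.fst.comp Primrec.snd) Primrec.fst)
      (Primrec.eq.comp (Primrec.list_getElem?.comp (Primrec.snd.comp Primrec.snd) Primrec.fst)
        (Primrec.const _))).not
  refine PrimrecPred.of_eq (PrimrecRel.comp h.forall_mem_list (Primrec.list_range.comp
    (Primrec.list_length.comp Primrec.snd)) Primrec.id) fun x => ?_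
  simp only [List.mem_range, id_eq, not_and, Vanishes]
  refine forall_congr' fun s => ⟨fun h hs hx => ?_, fun h _ => h⟩
  exact h (List.getElem?_eq_some_iff.1 hx).1 hs hx

end Vanishing

theorem MeagerEngulfing.high {A : Set ℕ} (hA : MeagerEngulfing A) : High A := by
  obtain ⟨S, ⟨C, ⟨W, hW, hCW⟩, hC, hSC⟩, hS⟩ := hA
  obtain ⟨q, hq, hqJ⟩ := (rePredIn_mem_jump (jump ∅)).exists_not_of_jump
  have hq' := rePredIn_empty_iff.1 hq
  obtain ⟨U, hU, hUq⟩ := exists_primrecRel_infinite hq'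
  -- That `∅''` is r.e. in the jump of `A` holds for every oracle; engulfing is needed only for the
  -- complement.
  refine turingLE_iff.2 ⟨(rePredIn_jump_of_exists_not (rePredIn_of_rePred hq')).of_eq
    fun e => (hqJ e).symm, ?_⟩
  obtain ⟨R, hR, hRW⟩ := hW.exists_rePred
  have hV := primrecRel_vanishes hU
  -- An escape is witnessed by finite strings, so it can be found by a search relative to `A`,
  -- uniformly in `e`, `m` and `σ`.
  have hescape : REPredIn A fun x : ℕ × ℕ × List Bool => ¬ Vanishes (U x.1) x.2.2 ∨
      ∃ z : List Bool × List Bool, ((x.2.2 <+: z.1 ∧ z.2 <+: z.1) ∧ Vanishes (U x.1) z.1) ∧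
        W (x.2.1, z.2) := by
    refine REPredIn.or (rePredIn_of_rePred (rePred_of_primrec
      (hV.comp Primrec.fst (Primrec.snd.comp Primrec.snd)).not)) ?_
    refine (rePredIn_of_initSeg (R := fun π (x : ℕ × ℕ × List Bool) =>
      ∃ z : List Bool × List Bool, ((x.2.2 <+: z.1 ∧ z.2 <+: z.1) ∧ Vanishes (U x.1) z.1) ∧
        R π (x.2.1, z.2)) ?_).of_eq fun x => ?_
    · have hx : Primrec fun y : (List Bool × ℕ × ℕ × List Bool) × List Bool × List Bool =>
          y.1.2 := Primrec.snd.comp Primrec.fst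
      have hσ : Primrec fun y : (List Bool × ℕ × ℕ × List Bool) × List Bool × List Bool =>
          y.1.2.2.2 := Primrec.snd.comp (Primrec.snd.comp hx)
      have hτ : Primrec fun y : (List Bool × ℕ × ℕ × List Bool) × List Bool × List Bool =>
          y.2.1 := Primrec.fst.comp Primrec.snd
      have hρ : Primrec fun y : (List Bool × ℕ × ℕ × List Bool) × List Bool × List Bool =>
          y.2.2 := Primrec.snd.comp Primrec.snd
      have hR' : REPred fun y : (List Bool × ℕ × ℕ × List Bool) × List Bool × List Bool =>
          R y.1.1 (y.1.2.2.1, y.2.2) :=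
        rePred_comp (f := fun y : (List Bool × ℕ × ℕ × List Bool) × List Bool × List Bool =>
          (y.1.1, (y.1.2.2.1, y.2.2))) hR ((Primrec.fst.comp Primrec.fst).pair
            ((Primrec.fst.comp (Primrec.snd.comp hx)).pair hρ)).to_comp
      exact rePred_exists (rePred_and (rePred_of_primrec (PrimrecPred.and (PrimrecPred.and
        (primrecRel_prefix.comp hσ hτ) (primrecRel_prefix.comp hρ hτ))
          (hV.comp (Primrec.fst.comp hx) hτ))) hR')
    · rw [exists_comm]
      simp only [hRW, exists_and_left]
  refine (rePredIn_jump_of_exists_not (q := fun (e : ℕ) (y : ℕ × List Bool) =>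
    ¬ Vanishes (U e) y.2 ∨ ∃ z : List Bool × List Bool,
      ((y.2 <+: z.1 ∧ z.2 <+: z.1) ∧ Vanishes (U e) z.1) ∧ W (y.1, z.2)) hescape).of_eq fun e => ?_
  rw [← infinite_iff_exists_not_escape hCW hC, ← hUq, hqJ]
  · simp
  · intro hinf
    exact (hS _ (effectivelyMeager_vanishing
      (hU.comp (Primrec.const e) Primrec.id) hinf)).trans hSC

end HighMeager

theorem theorem4p2 (A : Set ℕ) :
    [HighMeager.High A,
      ∃ G : ℕ → Set (ℕ → Bool), HighMeager.IsUniformPi01 A G ∧ (∀ k, IsNowhereDense (G k)) ∧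
        ∀ P : Set (ℕ → Bool), HighMeager.IsPi01 ∅ P → IsNowhereDense P → ∃ k, G k = P,
      HighMeager.MeagerEngulfing A].TFAE := by
  tfae_have 1 → 2 := fun h => h.exists_listing
  tfae_have 2 → 3 := fun ⟨_, hG, hnd, hall⟩ => .of_listing hG hnd hall
  tfae_have 3 → 1 := fun h => h.high
  tfae_finish
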